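/- All graphs are finite, simple and undirected. For positive integers $m,n$, the $n$-subdivision $G^{1/n}$ of a graph $G$ is the graph obtained by replacing each edge of $G$ with a path of length $n$, and the fractional power $G^{m/n}$ is the $m$-th power of $G^{1/n}$: it has the same vertices as $G^{1/n}$, and two distinct vertices are adjacent in $G^{m/n}$ if and only if their distance in $G^{1/n}$ is at most $m$. Let $\Delta$, $\chi$ and $\omega$ denote maximum degree, chromatic number and clique number. Theorem 5. Let $G$ be a connected graph and let $m>1$ be an integer. (a) If $m$ is even and $\Delta(G)\geq 4$, then $\chi(G^{m/n})=\omega(G^{m/n})$ for every integer $n\geq 2m+2$. (b) If $m$ is odd and $\Delta(G)\geq 5$, then $\chi(G^{m/n})=\omega(G^{m/n})$ for every integer $n\geq 2m+2$. -/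

import Mathlib

/-- The vertices of the `n`-subdivision of `G`: the vertices of `G` (terminal vertices) and, for
every edge of `G`, `n - 1` new (internal) vertices. -/
abbrev SubdivVertex {V : Type*} (G : SimpleGraph V) (n : ℕ) : Type _ :=
  V ⊕ (G.edgeSet × Fin (n - 1))

/-- The hyperedge of the edge `e`, as the sequence of its vertices at positions `0, 1, …, n`. It is
traversed from the first to the second end of `e`, in an arbitrary but fixed ordering of the two
ends of `e` (another ordering gives an isomorphic subdivision). The positions `1, …, n - 1` hold the
internal vertices that belong to `e`, the positions `0` and `n` the ends of `e`. -/
noncomputable def hyperedgeVertex {V : Type*} (G : SimpleGraph V) (n : ℕ) (e : G.edgeSet) (l : ℕ) :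
    SubdivVertex G n :=
  if h₀ : l = 0 then Sum.inl (Quot.out (e : Sym2 V)).1
  else if h : l < n then Sum.inr (e, ⟨l - 1, by omega⟩)
  else Sum.inl (Quot.out (e : Sym2 V)).2

/-- The `n`-subdivision `G^{1/n}` of `G` (for `n ≥ 1`): every edge of `G` is replaced by a path of
length `n`. Two vertices are adjacent if they are consecutive on some hyperedge. -/
def subdivision {V : Type*} (G : SimpleGraph V) (n : ℕ) : SimpleGraph (SubdivVertex G n) :=
  SimpleGraph.fromRel fun x y => ∃ (e : G.edgeSet) (l : ℕ), l < n ∧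
    x = hyperedgeVertex G n e l ∧ y = hyperedgeVertex G n e (l + 1)

/-- The `k`-power of `G`: distinct vertices are adjacent if their distance in `G` is at most `k`
(the extended distance, which is infinite between different connected components). -/
def graphPower {V : Type*} (G : SimpleGraph V) (k : ℕ) : SimpleGraph V where
  Adj x y := x ≠ y ∧ G.edist x y ≤ k
  symm := ⟨fun _ _ h => ⟨h.1.symm, SimpleGraph.edist_comm ▸ h.2⟩⟩
  loopless := ⟨fun _ h => h.1 rfl⟩

/-- The fractional power `G^{m/n}`: the `m`-power of the `n`-subdivision of `G`. -/
def fracPower {V : Type*} (G : SimpleGraph V) (m n : ℕ) : SimpleGraph (SubdivVertex G n) :=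
  graphPower (subdivision G n) m

/-! Put k = m / 2 and N = k * Δ + 1 + m % 2; both χ and ω equal N.

Clique (`le_cliqueNum_fracPower`): take a vertex of maximum degree, everything within distance k of
it and, for odd m, one vertex at distance k + 1.

Colouring (`fracPower_colorable`): terminal vertices get 0, and the edges at each vertex v get
distinct labels below Δ. Positions 1, …, k from v on the edge labelled a use k colours reserved for
a; for odd m, position k + 1 uses one colour common to all labels. The remaining positions up to m
run backwards through the colours of another label c. By `blockColor_eq`, internal vertices of
different hyperedges at v with equal colours have offsets of sum at least m + 1, whatever the labels
c are. Hence each hyperedge can be completed independently of the others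
(`exists_hyperedge_coloring`): its middle is coloured greedily, which needs N ≥ 2m + 1. This is
where the bounds on Δ come from. -/

section Subdivision

variable {V : Type*} {G : SimpleGraph V} {n : ℕ}

/-! ### Ends of hyperedges and offsets from them -/

/-- The end of a hyperedge at position `0`. -/
noncomputable def firstEnd (e : G.edgeSet) : V := (Quot.out (e : Sym2 V)).1

/-- The end of a hyperedge at position `n`. -/
noncomputable def secondEnd (e : G.edgeSet) : V := (Quot.out (e : Sym2 V)).2

theorem mk_firstEnd_secondEnd (e : G.edgeSet) : s(firstEnd e, secondEnd e) = (e : Sym2 V) :=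
  Quot.out_eq (e : Sym2 V)

theorem firstEnd_ne_secondEnd (e : G.edgeSet) : firstEnd e ≠ secondEnd e := by
  have h : G.Adj (firstEnd e) (secondEnd e) := by
    rw [← SimpleGraph.mem_edgeSet, mk_firstEnd_secondEnd]
    exact e.2
  exact h.ne

theorem mem_edge_iff {e : G.edgeSet} {v : V} :
    v ∈ (e : Sym2 V) ↔ v = firstEnd e ∨ v = secondEnd e := by
  rw [← mk_firstEnd_secondEnd e, Sym2.mem_iff]

theorem hyperedgeVertex_zero (e : G.edgeSet) :
    hyperedgeVertex G n e 0 = Sum.inl (firstEnd e) := by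
  simp [hyperedgeVertex, firstEnd]

theorem hyperedgeVertex_last (hn : 0 < n) (e : G.edgeSet) :
    hyperedgeVertex G n e n = Sum.inl (secondEnd e) := by
  simp [hyperedgeVertex, secondEnd, hn.ne']

theorem hyperedgeVertex_internal (e : G.edgeSet) {l : ℕ} (h₀ : 0 < l) (h : l < n) :
    hyperedgeVertex G n e l = Sum.inr (e, ⟨l - 1, by omega⟩) := by
  simp [hyperedgeVertex, h₀.ne', h]

/-- The edge `e` has the end `v`, and its vertex at position `l` is `p` steps away from `v`. -/
def IsOffset (n : ℕ) (v : V) (e : G.edgeSet) (l p : ℕ) : Prop :=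
  (v = firstEnd e ∧ l = p) ∨ (v = secondEnd e ∧ l + p = n)

theorem IsOffset.mem {v : V} {e : G.edgeSet} {l p : ℕ} (h : IsOffset n v e l p) :
    v ∈ (e : Sym2 V) := by
  rw [mem_edge_iff]
  exact h.imp And.left And.left

theorem exists_isOffset {v : V} {e : G.edgeSet} (hv : v ∈ (e : Sym2 V)) {p : ℕ} (hp : p ≤ n) :
    ∃ l, IsOffset n v e l p := by
  rcases mem_edge_iff.1 hv with h | h
  · exact ⟨p, Or.inl ⟨h, rfl⟩⟩
  · exact ⟨n - p, Or.inr ⟨h, by omega⟩⟩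

/-! ### Lower bounds for distances -/

theorem abs_sub_le_of_walk {W : Type*} {H : SimpleGraph W} {F : W → ℤ}
    (hF : ∀ x y, H.Adj x y → |F x - F y| ≤ 1) {x y : W} (p : H.Walk x y) :
    |F x - F y| ≤ p.length := by
  induction p with
  | nil => simp
  | cons h p ih =>
    have h₁ := hF _ _ h
    rw [SimpleGraph.Walk.length_cons]
    push_cast
    rw [abs_le] at *
    constructor <;> linarith [h₁.1, h₁.2, ih.1, ih.2]

/-- A function that changes by at most one along every hyperedge is 1-Lipschitz. -/
theorem abs_sub_le_of_edist_le {F : SubdivVertex G n → ℤ}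
    (hF : ∀ (e : G.edgeSet) (l : ℕ), l < n →
      |F (hyperedgeVertex G n e l) - F (hyperedgeVertex G n e (l + 1))| ≤ 1)
    {x y : SubdivVertex G n} {m : ℕ} (h : (subdivision G n).edist x y ≤ m) :
    |F x - F y| ≤ m := by
  have hreach : (subdivision G n).Reachable x y := by
    rw [← SimpleGraph.edist_ne_top_iff_reachable]
    exact ne_top_of_le_ne_top (ENat.natCast_ne_top m) h
  obtain ⟨p, hp⟩ := hreach.exists_walk_length_eq_edist
  rw [← hp] at h
  have hadj : ∀ x y, (subdivision G n).Adj x y → |F x - F y| ≤ 1 := by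
    intro x y hxy
    rw [subdivision, SimpleGraph.fromRel_adj] at hxy
    rcases hxy.2 with ⟨e, l, hl, rfl, rfl⟩ | ⟨e, l, hl, rfl, rfl⟩
    · exact hF e l hl
    · rw [abs_sub_comm]
      exact hF e l hl
  exact (abs_sub_le_of_walk hadj p).trans (by exact_mod_cast h)

open Classical in
/-- The distance to the terminal vertex `v`, capped at `n`. -/
noncomputable def terminalDist (n : ℕ) (v : V) : SubdivVertex G n → ℤ
  | Sum.inl w => if w = v then 0 else n
  | Sum.inr (e, i) =>
    if v = firstEnd e then (i : ℤ) + 1 else if v = secondEnd e then n - (i + 1) else n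

theorem terminalDist_hyperedgeVertex_of_first (v : V) (e : G.edgeSet) (he : v = firstEnd e)
    {l : ℕ} (hl : l ≤ n) (hn : 0 < n) : terminalDist n v (hyperedgeVertex G n e l) = l := by
  have hne := firstEnd_ne_secondEnd e
  rcases Nat.eq_zero_or_pos l with rfl | h₀
  · simp [hyperedgeVertex_zero, terminalDist, he]
  rcases hl.eq_or_lt with rfl | hl
  · simp [hyperedgeVertex_last hn, terminalDist, he, hne.symm]
  · rw [hyperedgeVertex_internal e h₀ hl]
    simp only [terminalDist, he, if_true]
    omega

theorem terminalDist_hyperedgeVertex_of_second (v : V) (e : G.edgeSet) (he : v = secondEnd e)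
    {l : ℕ} (hl : l ≤ n) (hn : 0 < n) : terminalDist n v (hyperedgeVertex G n e l) = n - l := by
  have hne := firstEnd_ne_secondEnd e
  rcases Nat.eq_zero_or_pos l with rfl | h₀
  · simp [hyperedgeVertex_zero, terminalDist, he, hne]
  rcases hl.eq_or_lt with rfl | hl
  · simp [hyperedgeVertex_last hn, terminalDist, he]
  · rw [hyperedgeVertex_internal e h₀ hl]
    simp only [terminalDist, he, hne.symm, if_true, if_false]
    omega

theorem terminalDist_hyperedgeVertex_of_notMem (v : V) (e : G.edgeSet) (he : v ∉ (e : Sym2 V))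
    {l : ℕ} (hl : l ≤ n) (hn : 0 < n) : terminalDist n v (hyperedgeVertex G n e l) = n := by
  rw [mem_edge_iff, not_or] at he
  rcases Nat.eq_zero_or_pos l with rfl | h₀
  · simp [hyperedgeVertex_zero, terminalDist, Ne.symm he.1]
  rcases hl.eq_or_lt with rfl | hl
  · simp [hyperedgeVertex_last hn, terminalDist, Ne.symm he.2]
  · rw [hyperedgeVertex_internal e h₀ hl]
    simp [terminalDist, he.1, he.2]

/-- Along a hyperedge the function has slope 1 or -1 if `v` is an end, and is constant otherwise. -/
theorem abs_terminalDist_sub_le (v : V) {x y : SubdivVertex G n} {m : ℕ}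
    (h : (subdivision G n).edist x y ≤ m) :
    |terminalDist n v x - terminalDist n v y| ≤ m := by
  refine abs_sub_le_of_edist_le (fun e l hl => ?_) h
  by_cases hv : v ∈ (e : Sym2 V)
  · rcases mem_edge_iff.1 hv with hv | hv
    · rw [terminalDist_hyperedgeVertex_of_first v e hv hl.le (by omega),
        terminalDist_hyperedgeVertex_of_first v e hv hl (by omega), abs_le]
      omega
    · rw [terminalDist_hyperedgeVertex_of_second v e hv hl.le (by omega),
        terminalDist_hyperedgeVertex_of_second v e hv hl (by omega), abs_le]
      omega
  · rw [terminalDist_hyperedgeVertex_of_notMem v e hv hl.le (by omega),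
      terminalDist_hyperedgeVertex_of_notMem v e hv hl (by omega)]
    simp

open Classical in
/-- The distance to the nearest terminal vertex, with a minus sign outside the hyperedge `e`. -/
noncomputable def signedDepth (n : ℕ) (e : G.edgeSet) : SubdivVertex G n → ℤ
  | Sum.inl _ => 0
  | Sum.inr (f, i) => (if f = e then 1 else -1) * min ((i : ℤ) + 1) (n - (i + 1))

theorem signedDepth_hyperedgeVertex (e f : G.edgeSet) {l : ℕ} (hl : l ≤ n) (hn : 0 < n)
    [Decidable (f = e)] : signedDepth n e (hyperedgeVertex G n f l) =
      (if f = e then 1 else -1) * min (l : ℤ) (n - l) := by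
  rcases Nat.eq_zero_or_pos l with rfl | h₀
  · simp [hyperedgeVertex_zero, signedDepth]
  rcases hl.eq_or_lt with rfl | hl
  · simp [hyperedgeVertex_last hn, signedDepth]
  · rw [hyperedgeVertex_internal f h₀ hl]
    have : ((l - 1 : ℕ) : ℤ) + 1 = l := by omega
    by_cases hf : f = e <;> simp [signedDepth, hf, this]

/-- Between a vertex of `e` and one of another hyperedge, the opposite signs make this a bound on
the sum of the two depths. -/
theorem abs_signedDepth_sub_le (e : G.edgeSet) {x y : SubdivVertex G n} {m : ℕ}
    (h : (subdivision G n).edist x y ≤ m) :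
    |signedDepth n e x - signedDepth n e y| ≤ m := by
  classical
  refine abs_sub_le_of_edist_le (fun f l hl => ?_) h
  rw [signedDepth_hyperedgeVertex e f hl.le (by omega),
    signedDepth_hyperedgeVertex e f hl (by omega), abs_le]
  split_ifs <;> push_cast <;> omega

/-- Terminal vertices are far apart. -/
theorem terminal_eq_of_edist_le {v w : V} {m : ℕ} (hmn : m < n)
    (h : (subdivision G n).edist (Sum.inl v) (Sum.inl w) ≤ m) : v = w := by
  by_contra hne
  have := abs_terminalDist_sub_le v h
  simp only [terminalDist, if_true, if_neg (Ne.symm hne), abs_le] at this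
  omega

/-- A vertex at a short distance from a terminal vertex `v` lies on a hyperedge with end `v`. -/
theorem exists_isOffset_of_edist_le {v : V} {e : G.edgeSet} {l m : ℕ} (hmn : m < n) (hl : l < n)
    (h : (subdivision G n).edist (Sum.inl v) (hyperedgeVertex G n e l) ≤ m) :
    ∃ p ≤ m, IsOffset n v e l p := by
  have hd := abs_terminalDist_sub_le v h
  have hv₀ : terminalDist (G := G) n v (Sum.inl v) = 0 := by simp [terminalDist]
  rw [hv₀, abs_le] at hd
  by_cases hv : v ∈ (e : Sym2 V)
  · rcases mem_edge_iff.1 hv with hv | hv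
    · rw [terminalDist_hyperedgeVertex_of_first v e hv hl.le (by omega)] at hd
      exact ⟨l, by omega, Or.inl ⟨hv, rfl⟩⟩
    · rw [terminalDist_hyperedgeVertex_of_second v e hv hl.le (by omega)] at hd
      exact ⟨n - l, by omega, Or.inr ⟨hv, by omega⟩⟩
  · rw [terminalDist_hyperedgeVertex_of_notMem v e hv hl.le (by omega)] at hd
    omega

/-- Distances on a hyperedge are the differences of the positions. -/
theorem sub_le_of_edist_le {e : G.edgeSet} {l l' m : ℕ} (hl : l < n) (hl' : l' < n)
    (h : (subdivision G n).edist (hyperedgeVertex G n e l) (hyperedgeVertex G n e l') ≤ m) :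
    l ≤ l' + m ∧ l' ≤ l + m := by
  have hd := abs_terminalDist_sub_le (firstEnd e) h
  rw [terminalDist_hyperedgeVertex_of_first _ e rfl hl.le (by omega),
    terminalDist_hyperedgeVertex_of_first _ e rfl hl'.le (by omega), abs_le] at hd
  omega

/-- Vertices of different hyperedges at a short distance are close to a common end. -/
theorem exists_common_end_of_edist_le {e f : G.edgeSet} (hef : e ≠ f) {l l' m : ℕ}
    (hmn : 2 * m < n) (hl₀ : 0 < l) (hl : l < n) (hl₀' : 0 < l') (hl' : l' < n)
    (h : (subdivision G n).edist (hyperedgeVertex G n e l) (hyperedgeVertex G n f l') ≤ m) :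
    ∃ v p q, 0 < p ∧ 0 < q ∧ p + q ≤ m ∧ IsOffset n v e l p ∧ IsOffset n v f l' q := by
  classical
  have hd := abs_signedDepth_sub_le e h
  rw [signedDepth_hyperedgeVertex e e hl.le (by omega),
    signedDepth_hyperedgeVertex e f hl'.le (by omega), if_pos rfl, if_neg hef.symm, abs_le] at hd
  -- `v` is an end of `e` nearest to the first vertex, so `p` is the depth of that vertex.
  obtain ⟨v, p, hp₀, hp, hvp⟩ : ∃ (v : V) (p : ℕ), 0 < p ∧ (p : ℤ) = min (l : ℤ) (n - l) ∧
      IsOffset n v e l p := by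
    rcases le_total (l : ℤ) (n - l) with hle | hle
    · exact ⟨firstEnd e, l, hl₀, (min_eq_left hle).symm, Or.inl ⟨rfl, rfl⟩⟩
    · exact ⟨secondEnd e, n - l, by omega, by rw [min_eq_right hle]; omega,
        Or.inr ⟨rfl, by omega⟩⟩
  have hxv : terminalDist n v (hyperedgeVertex G n e l) = p := by
    rcases hvp with ⟨hv, rfl⟩ | ⟨hv, hlp⟩
    · exact terminalDist_hyperedgeVertex_of_first v e hv hl.le (by omega)
    · rw [terminalDist_hyperedgeVertex_of_second v e hv hl.le (by omega)]
      omega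
  have hd' := abs_terminalDist_sub_le v h
  rw [hxv, abs_le] at hd'
  -- If `v` were the farther end of `f`, or not an end of `f`, the two Lipschitz bounds would give n
  -- ≤ 2m.
  by_cases hv : v ∈ (f : Sym2 V)
  · rcases mem_edge_iff.1 hv with hv | hv
    · rw [terminalDist_hyperedgeVertex_of_first v f hv hl'.le (by omega)] at hd'
      exact ⟨v, p, l', hp₀, hl₀', by omega, hvp, Or.inl ⟨hv, rfl⟩⟩
    · rw [terminalDist_hyperedgeVertex_of_second v f hv hl'.le (by omega)] at hd'
      exact ⟨v, p, n - l', hp₀, by omega, by omega, hvp, Or.inr ⟨hv, by omega⟩⟩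
  · rw [terminalDist_hyperedgeVertex_of_notMem v f hv hl'.le (by omega)] at hd'
    omega

/-! ### Upper bounds for distances -/

theorem edist_hyperedgeVertex_add_le (e : G.edgeSet) (l d : ℕ) (h : l + d ≤ n) :
    (subdivision G n).edist (hyperedgeVertex G n e l) (hyperedgeVertex G n e (l + d)) ≤ d := by
  induction d with
  | zero => simp
  | succ d ih =>
    have hstep : (subdivision G n).edist (hyperedgeVertex G n e (l + d))
        (hyperedgeVertex G n e (l + (d + 1))) ≤ 1 := by
      rw [SimpleGraph.edist_le_one_iff_adj_or_eq]
      by_cases heq : hyperedgeVertex G n e (l + d) = hyperedgeVertex G n e (l + (d + 1))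
      · exact Or.inr heq
      · left
        rw [subdivision, SimpleGraph.fromRel_adj]
        exact ⟨heq, Or.inl ⟨e, l + d, by omega, rfl, rfl⟩⟩
    calc _ ≤ _ := SimpleGraph.edist_triangle (v := hyperedgeVertex G n e (l + d))
      _ ≤ (d : ℕ∞) + 1 := add_le_add (ih (by omega)) hstep
      _ = _ := by push_cast; rfl

theorem edist_terminal_le {v : V} {e : G.edgeSet} {l p : ℕ} (h : IsOffset n v e l p)
    (hn : 0 < n) (hp : p ≤ n) :
    (subdivision G n).edist (Sum.inl v) (hyperedgeVertex G n e l) ≤ p := by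
  rcases h with ⟨rfl, rfl⟩ | ⟨rfl, h⟩
  · have := edist_hyperedgeVertex_add_le (n := n) e 0 l (by omega)
    rwa [hyperedgeVertex_zero, zero_add] at this
  · have := edist_hyperedgeVertex_add_le (n := n) e l p (by omega)
    rwa [h, hyperedgeVertex_last hn, SimpleGraph.edist_comm] at this

end Subdivision

/-! ### Colouring a hyperedge -/

/-- The colour with label `a` and index `i`. The colours with index `0` or `k + 1` do not depend on
the label. -/
def labelColor (k Δ a i : ℕ) : ℕ :=
  if i = 0 then 0 else if i ≤ k then a * k + i else k * Δ + 1

theorem mul_add_le_mul {k Δ a i : ℕ} (ha : a < Δ) (hi : i ≤ k) : a * k + i ≤ k * Δ := by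
  calc a * k + i ≤ (a + 1) * k := by rw [add_mul]; omega
    _ ≤ Δ * k := Nat.mul_le_mul_right k ha
    _ = k * Δ := mul_comm _ _

theorem mul_add_inj {k a b i j : ℕ} (hi₀ : 0 < i) (hi : i ≤ k) (hj₀ : 0 < j) (hj : j ≤ k)
    (h : a * k + i = b * k + j) : a = b ∧ i = j := by
  have hab : a = b := by
    rcases lt_trichotomy a b with hlt | heq | hlt
    · have := mul_add_le_mul hlt hi
      rw [mul_comm k] at this
      omega
    · exact heq
    · have := mul_add_le_mul hlt hj
      rw [mul_comm k] at this
      omega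
  subst hab
  exact ⟨rfl, by omega⟩

/-- Indices 1, …, k give disjoint blocks of k colours, one per label; 0 and k * Δ + 1 lie outside
all blocks. -/
theorem labelColor_eq {k Δ a b i j : ℕ} (ha : a < Δ) (hb : b < Δ) (hi : i ≤ k + 1)
    (hj : j ≤ k + 1) (h : labelColor k Δ a i = labelColor k Δ b j) :
    i = j ∧ (a = b ∨ i = 0 ∨ i = k + 1) := by
  unfold labelColor at h
  split_ifs at h with h₁ h₂ h₃ h₄ h₅ h₆ h₇ h₈
  all_goals first
    | omega
    | (have := mul_add_inj (by omega) (by omega) (by omega) (by omega) h; omega)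
    | (have := mul_add_le_mul ha (i := i) (k := k) (by omega); omega)
    | (have := mul_add_le_mul hb (i := j) (k := k) (by omega); omega)

/-- The colours at distance `p ≤ m` from an end of a hyperedge: the label is `a` in the first half
and `c` in the second half, where the indices run backwards. -/
def blockColor (m Δ a c p : ℕ) : ℕ :=
  if 2 * p ≤ m + 1 then labelColor (m / 2) Δ a p else labelColor (m / 2) Δ c (m + 1 - p)

theorem blockColor_lt {m Δ a c p : ℕ} (ha : a < Δ) (hc : c < Δ) :
    blockColor m Δ a c p < m / 2 * Δ + 1 + m % 2 := by
  unfold blockColor labelColor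
  split_ifs
  all_goals first
    | omega
    | (have := mul_add_le_mul ha (i := p) (k := m / 2) (by omega); omega)
    | (have := mul_add_le_mul hc (i := m + 1 - p) (k := m / 2) (by omega); omega)

theorem blockColor_zero (m Δ a c : ℕ) : blockColor m Δ a c 0 = 0 := by
  simp [blockColor, labelColor]

/-- When two block colours agree, the positions agree or are opposite. -/
theorem blockColor_eq {m Δ a c b d p q : ℕ} (ha : a < Δ) (hc : c < Δ) (hb : b < Δ) (hd : d < Δ)
    (hp : p ≤ m) (hq : q ≤ m) (h : blockColor m Δ a c p = blockColor m Δ b d q) :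
    (2 * p ≤ m + 1 ∧ p = q ∧ (a = b ∨ p = 0 ∨ 2 * p = m + 1)) ∨
    (2 * p ≤ m + 1 ∧ m + 1 < 2 * q ∧ p + q = m + 1 ∧ a = d) ∨
    (m + 1 < 2 * p ∧ 2 * q ≤ m + 1 ∧ p + q = m + 1 ∧ c = b) ∨
    (m + 1 < 2 * p ∧ p = q ∧ c = d) := by
  unfold blockColor at h
  split_ifs at h with h₁ h₂ h₃
  · have := labelColor_eq ha hb (by omega) (by omega) h
    omega
  · have := labelColor_eq ha hd (by omega) (by omega) h
    omega
  · have := labelColor_eq hc hb (by omega) (by omega) h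
    omega
  · have := labelColor_eq hc hd (by omega) (by omega) h
    omega

/-- `f` colours the positions in `S` with colours less than `N`, such that positions at distance at
most `m` have different colours. -/
def IsPathColoring (m N : ℕ) (f : ℕ → ℕ) (S : Finset ℕ) : Prop :=
  (∀ p ∈ S, f p < N) ∧ ∀ p ∈ S, ∀ q ∈ S, p < q → q ≤ p + m → f p ≠ f q

/-- Greedy: a new position has at most 2m others within distance m, so one of the N colours is free.
-/
theorem IsPathColoring.exists_extend {m N : ℕ} (hN : 2 * m + 1 ≤ N) {f : ℕ → ℕ} {S : Finset ℕ}
    (hf : IsPathColoring m N f S) (T : Finset ℕ) :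
    ∃ g, (∀ p ∈ S, g p = f p) ∧ IsPathColoring m N g (S ∪ T) := by
  induction T using Finset.induction_on with
  | empty => exact ⟨f, fun _ _ => rfl, by simpa using hf⟩
  | insert t T _ ih =>
    obtain ⟨g, hgf, hg⟩ := ih
    by_cases ht : t ∈ S ∪ T
    · refine ⟨g, hgf, ?_⟩
      rwa [Finset.union_insert, Finset.insert_eq_of_mem ht]
    set used := ((Finset.Icc (t - m) (t + m)).erase t).image g with hused
    have hcard : used.card < (Finset.range N).card := by
      calc used.card ≤ ((Finset.Icc (t - m) (t + m)).erase t).card := Finset.card_image_le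
        _ < (Finset.range N).card := by
          rw [Finset.card_erase_of_mem (by simp), Nat.card_Icc, Finset.card_range]
          omega
    obtain ⟨c, hcN, hc⟩ := Finset.exists_mem_notMem_of_card_lt_card hcard
    have hne : ∀ p ∈ S ∪ T, t ≤ p + m → p ≤ t + m → c ≠ g p := by
      rintro p hp h₁ h₂ rfl
      refine hc (Finset.mem_image_of_mem g (Finset.mem_erase.2 ⟨?_, ?_⟩))
      · rintro rfl
        exact ht hp
      · rw [Finset.mem_Icc]
        omega
    have hupd : ∀ p ∈ S ∪ T, Function.update g t c p = g p := by
      intro p hp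
      refine Function.update_of_ne ?_ _ _
      rintro rfl
      exact ht hp
    refine ⟨Function.update g t c, fun p hp => ?_, ?_, ?_⟩
    · rw [hupd p (Finset.mem_union_left _ hp), hgf p hp]
    · intro p hp
      rw [Finset.union_insert, Finset.mem_insert] at hp
      rcases hp with rfl | hp
      · rw [Function.update_self]
        exact Finset.mem_range.1 hcN
      · rw [hupd p hp]
        exact hg.1 p hp
    · intro p hp q hq hpq hqm
      rw [Finset.union_insert, Finset.mem_insert] at hp hq
      rcases hp with rfl | hp
      · rcases hq with rfl | hq
        · omega
        · rw [Function.update_self, hupd q hq]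
          exact hne q hq (by omega) hqm
      · rcases hq with rfl | hq
        · rw [Function.update_self, hupd p hp]
          exact (hne p hp hqm (by omega)).symm
        · rw [hupd p hp, hupd q hq]
          exact hg.2 p hp q hq hpq hqm

/-- A hyperedge can be coloured with prescribed labels `a` and `b` at its ends. -/
theorem exists_hyperedge_coloring {m n Δ a b : ℕ} (hn : 2 * m + 2 ≤ n) (hΔ : 3 ≤ Δ)
    (hN : 2 * m + 1 ≤ m / 2 * Δ + 1 + m % 2) (ha : a < Δ) (hb : b < Δ) :
    ∃ f, IsPathColoring m (m / 2 * Δ + 1 + m % 2) f (Finset.range (n + 1)) ∧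
      (∃ c < Δ, ∀ p ≤ m, f p = blockColor m Δ a c p) ∧
      ∃ d < Δ, ∀ p ≤ m, f (n - p) = blockColor m Δ b d p := by
  obtain ⟨c, hc, hca⟩ : ∃ c < Δ, c ≠ a := by
    by_cases h : a = 0
    · exact ⟨1, by omega, by omega⟩
    · exact ⟨0, by omega, by omega⟩
  -- c ≠ a and d ≠ b separate the two halves of each end block; d ≠ c separates the second halves of
  -- the two blocks. Three labels suffice.
  obtain ⟨d, hd, hdb, hdc⟩ : ∃ d < Δ, d ≠ b ∧ d ≠ c := by
    by_cases h₀ : b ≠ 0 ∧ c ≠ 0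
    · exact ⟨0, by omega, by omega, by omega⟩
    by_cases h₁ : b ≠ 1 ∧ c ≠ 1
    · exact ⟨1, by omega, by omega, by omega⟩
    · exact ⟨2, by omega, by omega, by omega⟩
  set f₀ : ℕ → ℕ := fun l => if l ≤ m then blockColor m Δ a c l else blockColor m Δ b d (n - l)
    with hf₀
  set S := (Finset.range (n + 1)).filter fun l => l ≤ m ∨ n ≤ l + m with hS
  have hpath : IsPathColoring m (m / 2 * Δ + 1 + m % 2) f₀ S := by
    constructor
    · intro p _
      simp only [hf₀]
      split_ifs
      · exact blockColor_lt ha hc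
      · exact blockColor_lt hb hd
    · intro p hp q hq hpq hqm heq
      simp only [hS, Finset.mem_filter, Finset.mem_range] at hp hq
      simp only [hf₀] at heq
      split_ifs at heq with h₁ h₂ h₂
      -- Equal colours at distinct positions of one block must be opposite, which forces a = c.
      · have := blockColor_eq ha hc ha hc h₁ h₂ heq
        omega
      -- As n ≥ 2m + 2, offsets from the two ends at distance at most m have sum at least m + 2.
      -- Only the case of two second halves allows this, and it needs c = d.
      · have := blockColor_eq ha hc hb hd h₁ (by omega) heq
        omega
      · omega
      · have := blockColor_eq hb hd hb hd (by omega) (by omega) heq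
        omega
  obtain ⟨g, hg, hgp⟩ := hpath.exists_extend hN (Finset.range (n + 1))
  refine ⟨g, ?_, ⟨c, hc, fun p hp => ?_⟩, d, hd, fun p hp => ?_⟩
  · rwa [Finset.union_eq_right.2 (Finset.filter_subset _ _)] at hgp
  · rw [hg p (by simp only [hS, Finset.mem_filter, Finset.mem_range]; omega)]
    simp only [hf₀, if_pos hp]
  · rw [hg (n - p) (by simp only [hS, Finset.mem_filter, Finset.mem_range]; omega)]
    simp only [hf₀]
    rw [if_neg (by omega), Nat.sub_sub_self (by omega)]

/-! ### The global colouring and the matching clique -/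

section FracPower

variable {V : Type*} [Fintype V] (G : SimpleGraph V) [DecidableRel G.Adj]

theorem card_edges_at (v : V) : Nat.card {e : G.edgeSet // v ∈ (e : Sym2 V)} = G.degree v := by
  classical
  rw [← SimpleGraph.card_incidenceSet_eq_degree, ← Nat.card_eq_fintype_card]
  exact Nat.card_congr (Equiv.subtypeSubtypeEquivSubtypeInter (· ∈ G.edgeSet) (v ∈ ·))

/-- The edges at every vertex can be labelled with distinct labels less than the maximum degree. -/
theorem exists_edge_labels : ∃ lab : V → G.edgeSet → ℕ,
    (∀ (v : V) (e : G.edgeSet), v ∈ (e : Sym2 V) → lab v e < G.maxDegree) ∧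
    ∀ (v : V) (e f : G.edgeSet), v ∈ (e : Sym2 V) → v ∈ (f : Sym2 V) →
      lab v e = lab v f → e = f := by
  classical
  have key : ∀ v, ∃ lab : G.edgeSet → ℕ,
      (∀ e : G.edgeSet, v ∈ (e : Sym2 V) → lab e < G.maxDegree) ∧
      ∀ e f : G.edgeSet, v ∈ (e : Sym2 V) → v ∈ (f : Sym2 V) → lab e = lab f → e = f := by
    intro v
    let φ := Finite.equivFin {e : G.edgeSet // v ∈ (e : Sym2 V)}
    refine ⟨fun e => if h : v ∈ (e : Sym2 V) then φ ⟨e, h⟩ else 0, ?_, ?_⟩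
    · intro e h
      simp only [dif_pos h]
      exact (φ ⟨e, h⟩).2.trans_le ((card_edges_at G v).trans_le (G.degree_le_maxDegree v))
    · intro e f he hf h
      simp only [dif_pos he, dif_pos hf] at h
      exact congrArg Subtype.val (φ.injective (Fin.ext h))
  choose lab h₁ h₂ using key
  exact ⟨lab, h₁, h₂⟩

theorem fracPower_colorable {m n : ℕ} (hn : 2 * m + 2 ≤ n) (hΔ : 3 ≤ G.maxDegree)
    (hN : 2 * m + 1 ≤ m / 2 * G.maxDegree + 1 + m % 2) :
    (fracPower G m n).Colorable (m / 2 * G.maxDegree + 1 + m % 2) := by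
  set Δ := G.maxDegree with hΔdef
  obtain ⟨lab, hlab, hinj⟩ := exists_edge_labels G
  have key : ∀ e : G.edgeSet, ∃ f : ℕ → ℕ,
      IsPathColoring m (m / 2 * Δ + 1 + m % 2) f (Finset.range (n + 1)) ∧
      ∀ v l p, p ≤ m → IsOffset n v e l p →
        ∃ c < Δ, f l = blockColor m Δ (lab v e) c p := by
    intro e
    obtain ⟨f, hf, ⟨c, hc, hfc⟩, d, hd, hfd⟩ := exists_hyperedge_coloring hn hΔ hN
      (hlab (firstEnd e) e (mem_edge_iff.2 (Or.inl rfl)))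
      (hlab (secondEnd e) e (mem_edge_iff.2 (Or.inr rfl)))
    refine ⟨f, hf, ?_⟩
    rintro v l p hp (⟨rfl, rfl⟩ | ⟨rfl, h⟩)
    · exact ⟨c, hc, hfc l hp⟩
    · refine ⟨d, hd, ?_⟩
      rw [← hfd p hp, ← h, Nat.add_sub_cancel]
  choose f hf hfb using key
  have hx : ∀ (e : G.edgeSet) (i : Fin (n - 1)),
      (Sum.inr (e, i) : SubdivVertex G n) = hyperedgeVertex G n e (i + 1) := by
    intro e i
    have hi := i.2
    rw [hyperedgeVertex_internal e (by omega) (by omega)]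
    rfl
  have hterm : ∀ (v : V) (e : G.edgeSet) (i : Fin (n - 1)),
      (subdivision G n).edist (Sum.inl v) (Sum.inr (e, i)) ≤ m → f e (i + 1) ≠ 0 := by
    intro v e i h h₀
    have hi := i.2
    rw [hx e i] at h
    obtain ⟨p, hp, hvp⟩ := exists_isOffset_of_edist_le (by omega) (by omega) h
    obtain ⟨c, hc, hcol⟩ := hfb e v _ p hp hvp
    have ha := hlab v e hvp.mem
    -- Colour 0 is compared with offset 0: a repetition would need offset 0 or m + 1.
    rw [h₀, ← blockColor_zero m Δ (lab v e) c] at hcol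
    have := blockColor_eq ha hc ha hc (by omega) hp hcol
    unfold IsOffset at hvp
    omega
  have hinner : ∀ (e e' : G.edgeSet) (i i' : Fin (n - 1)),
      (Sum.inr (e, i) : SubdivVertex G n) ≠ Sum.inr (e', i') →
      (subdivision G n).edist (Sum.inr (e, i)) (Sum.inr (e', i')) ≤ m →
      f e (i + 1) ≠ f e' (i' + 1) := by
    intro e e' i i' hne h heq
    have hi := i.2
    have hi' := i'.2
    rw [hx e i, hx e' i'] at h
    by_cases hee : e = e'
    · subst hee
      have hd := sub_le_of_edist_le (by omega) (by omega) h
      have hii : (i : ℕ) ≠ i' := by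
        intro h
        exact hne (by rw [Fin.ext h])
      rcases lt_or_gt_of_ne hii with hlt | hlt
      · exact (hf e).2 (i + 1) (by simp; omega) (i' + 1) (by simp; omega) (by omega) (by omega) heq
      · exact (hf e).2 (i' + 1) (by simp; omega) (i + 1) (by simp; omega) (by omega) (by omega)
          heq.symm
    · obtain ⟨v, p, q, hp₀, hq₀, hpq, hvp, hvq⟩ := exists_common_end_of_edist_le hee (by omega)
        (by omega) (by omega) (by omega) (by omega) h
      obtain ⟨c, hc, hcol⟩ := hfb e v _ p (by omega) hvp
      obtain ⟨d, hd, hcol'⟩ := hfb e' v _ q (by omega) hvq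
      rw [hcol, hcol'] at heq
      have hlne : lab v e ≠ lab v e' := fun h => hee (hinj v e e' hvp.mem hvq.mem h)
      -- Since p + q ≤ m, only equal offsets in the first halves remain, and they force equal
      -- labels.
      have := blockColor_eq (hlab v e hvp.mem) hc (hlab v e' hvq.mem) hd (by omega) (by omega) heq
      omega
  let col : SubdivVertex G n → ℕ := Sum.elim (fun _ => 0) fun x => f x.1 (x.2 + 1)
  have hcol : ∀ x, col x < m / 2 * Δ + 1 + m % 2 := by
    rintro (v | ⟨e, i⟩)
    · exact Nat.lt_of_lt_of_le (Nat.succ_pos _) hN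
    · have hi := i.2
      exact (hf e).1 (i + 1) (by simp; omega)
  refine ⟨SimpleGraph.Coloring.mk (fun x => ⟨col x, hcol x⟩) ?_⟩
  rintro x y ⟨hne, h⟩ heq
  replace heq : col x = col y := congrArg Fin.val heq
  rcases x with v | ⟨e, i⟩ <;> rcases y with w | ⟨e', i'⟩
  · exact hne (by rw [terminal_eq_of_edist_le (by omega) h])
  · exact hterm v e' i' h heq.symm
  · rw [SimpleGraph.edist_comm] at h
    exact hterm w e i h heq
  · exact hinner e e' i i' hne h heq

theorem le_cliqueNum_fracPower (hΔ : 0 < G.maxDegree) {m n : ℕ} (hn : 2 * m + 2 ≤ n) :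
    m / 2 * G.maxDegree + 1 + m % 2 ≤ (fracPower G m n).cliqueNum := by
  classical
  have hV : Nonempty V := by
    by_contra h
    rw [not_nonempty_iff] at h
    simp at hΔ
  obtain ⟨v, hv⟩ := G.exists_maximal_degree_vertex
  have hcard : Nat.card {e : G.edgeSet // v ∈ (e : Sym2 V)} = G.maxDegree := by
    rw [card_edges_at, hv]
  obtain ⟨e₀⟩ : Nonempty {e : G.edgeSet // v ∈ (e : Sym2 V)} := by
    by_contra h
    rw [not_nonempty_iff] at h
    rw [Nat.card_of_isEmpty] at hcard
    omega
  have hpos : ∀ (e : {e : G.edgeSet // v ∈ (e : Sym2 V)}) (p : ℕ), ∃ l, p ≤ n →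
      IsOffset n v e.1 l p := by
    intro e p
    by_cases hp : p ≤ n
    · obtain ⟨l, hl⟩ := exists_isOffset e.2 hp
      exact ⟨l, fun _ => hl⟩
    -- A junk value, so that `pos` is a total function.
    · exact ⟨0, fun h => absurd h hp⟩
  choose pos hpos using hpos
  let φ : Option ({e : G.edgeSet // v ∈ (e : Sym2 V)} × Fin (m / 2)) ⊕ Fin (m % 2) →
      SubdivVertex G n := Sum.elim
    (fun x => x.elim (Sum.inl v) fun y => hyperedgeVertex G n y.1.1 (pos y.1 (y.2 + 1)))
    fun _ => hyperedgeVertex G n e₀.1 (pos e₀ (m / 2 + 1))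
  let r : Option ({e : G.edgeSet // v ∈ (e : Sym2 V)} × Fin (m / 2)) ⊕ Fin (m % 2) → ℕ :=
    Sum.elim (fun x => x.elim 0 fun y => y.2 + 1) fun _ => m / 2 + 1
  have hr : ∀ x, (subdivision G n).edist (Sum.inl v) (φ x) ≤ r x := by
    rintro ((_ | ⟨e, i⟩) | _)
    · simp [φ]
    · have hi : (i : ℕ) + 1 ≤ n := by omega
      exact edist_terminal_le (hpos e (i + 1) hi) (by omega) hi
    · have hi : m / 2 + 1 ≤ n := by omega
      exact edist_terminal_le (hpos e₀ (m / 2 + 1) hi) (by omega) hi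
  -- Radius m / 2 + 1 occurs at most once, and only for odd m, where m / 2 + (m / 2 + 1) = m.
  have hrm : ∀ x y, x ≠ y → r x + r y ≤ m := by
    rintro ((_ | ⟨e, i, hi⟩) | ⟨i, hi⟩) ((_ | ⟨e', i', hi'⟩) | ⟨i', hi'⟩) hne
    case inl.none.inl.none => exact absurd rfl hne
    case inr.inr => exact absurd (congrArg Sum.inr (Fin.ext (by simp only; omega))) hne
    all_goals simp only [r, Sum.elim_inl, Sum.elim_inr, Option.elim]; omega
  have hvert : ∀ (e : {e : G.edgeSet // v ∈ (e : Sym2 V)}) (p : ℕ), 0 < p → p < n →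
      ∃ h, hyperedgeVertex G n e.1 (pos e p) = Sum.inr (e.1, ⟨pos e p - 1, h⟩) ∧
        0 < pos e p := by
    intro e p hp₀ hp
    have h := hpos e p hp.le
    unfold IsOffset at h
    exact ⟨by omega, hyperedgeVertex_internal e.1 (by omega) (by omega), by omega⟩
  have hvert_inj : ∀ (e e' : {e : G.edgeSet // v ∈ (e : Sym2 V)}) (p p' : ℕ), 0 < p → p < n →
      0 < p' → p' < n →
      hyperedgeVertex G n e.1 (pos e p) = hyperedgeVertex G n e'.1 (pos e' p') →
      e = e' ∧ p = p' := by
    intro e e' p p' hp₀ hp hp₀' hp' h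
    obtain ⟨_, h₁, h₁'⟩ := hvert e p hp₀ hp
    obtain ⟨_, h₂, h₂'⟩ := hvert e' p' hp₀' hp'
    rw [h₁, h₂, Sum.inr.injEq, Prod.mk.injEq, Fin.mk.injEq] at h
    have hee : e = e' := Subtype.ext h.1
    subst hee
    have o₁ := hpos e p hp.le
    have o₂ := hpos e p' hp'.le
    have hne := firstEnd_ne_secondEnd e.1
    refine ⟨rfl, ?_⟩
    rcases o₁ with ⟨a₁, b₁⟩ | ⟨a₁, b₁⟩ <;> rcases o₂ with ⟨a₂, b₂⟩ | ⟨a₂, b₂⟩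
    · omega
    · exact absurd (a₁.symm.trans a₂) hne
    · exact absurd (a₂.symm.trans a₁) hne
    · omega
  have hφ : Function.Injective φ := by
    rintro ((_ | ⟨e, i⟩) | i) ((_ | ⟨e', i'⟩) | i') h
    · rfl
    · obtain ⟨_, h', -⟩ := hvert e' (i' + 1) (by omega) (by omega)
      exact absurd (h.trans h') (by simp [φ])
    · obtain ⟨_, h', -⟩ := hvert e₀ (m / 2 + 1) (by omega) (by omega)
      exact absurd (h.trans h') (by simp [φ])
    · obtain ⟨_, h', -⟩ := hvert e (i + 1) (by omega) (by omega)
      exact absurd (h.symm.trans h') (by simp [φ])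
    · obtain ⟨rfl, h'⟩ := hvert_inj e e' (i + 1) (i' + 1) (by omega) (by omega) (by omega)
        (by omega) h
      rw [Fin.ext (Nat.succ_injective h')]
    · have := (hvert_inj e e₀ (i + 1) (m / 2 + 1) (by omega) (by omega) (by omega)
        (by omega) h).2
      omega
    · obtain ⟨_, h', -⟩ := hvert e₀ (m / 2 + 1) (by omega) (by omega)
      exact absurd (h.symm.trans h') (by simp [φ])
    · have := (hvert_inj e₀ e' (m / 2 + 1) (i' + 1) (by omega) (by omega) (by omega)
        (by omega) h).2
      omega
    · exact congrArg Sum.inr (Fin.ext (by omega))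
  have hclique : (fracPower G m n).IsClique (Finset.univ.image φ : Finset (SubdivVertex G n)) := by
    intro x hx y hy hne
    simp only [Finset.coe_image, Finset.coe_univ, Set.image_univ, Set.mem_range] at hx hy
    obtain ⟨x, rfl⟩ := hx
    obtain ⟨y, rfl⟩ := hy
    refine ⟨hne, ?_⟩
    calc _ ≤ _ := SimpleGraph.edist_triangle (v := Sum.inl v)
      _ ≤ (r x : ℕ∞) + r y :=
        add_le_add (by rw [SimpleGraph.edist_comm]; exact hr x) (hr y)
      _ ≤ m := by exact_mod_cast hrm x y (fun h => hne (congrArg φ h))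
  refine le_trans (le_of_eq ?_) hclique.card_le_cliqueNum
  rw [Finset.card_image_of_injective _ hφ, Finset.card_univ, Fintype.card_sum, Fintype.card_option,
    Fintype.card_prod, Fintype.card_fin, Fintype.card_fin, ← Nat.card_eq_fintype_card, hcard,
    mul_comm]

theorem chromaticNumber_fracPower_eq {m n : ℕ} (hn : 2 * m + 2 ≤ n) (hΔ : 3 ≤ G.maxDegree)
    (hN : 2 * m + 1 ≤ m / 2 * G.maxDegree + 1 + m % 2) :
    (fracPower G m n).chromaticNumber = ((fracPower G m n).cliqueNum : ℕ∞) := by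
  apply le_antisymm
  · exact (fracPower_colorable G hn hΔ hN).chromaticNumber_le.trans
      (by exact_mod_cast le_cliqueNum_fracPower G (by omega) hn)
  · exact SimpleGraph.cliqueNum_le_chromaticNumber

end FracPower

theorem theorem5 {V : Type*} [Fintype V] (G : SimpleGraph V) [DecidableRel G.Adj]
    (hG : G.Connected) (m : ℕ) (hm : 1 < m) :
    (Even m → 4 ≤ G.maxDegree → ∀ n : ℕ, 2 * m + 2 ≤ n →
      (fracPower G m n).chromaticNumber = ((fracPower G m n).cliqueNum : ℕ∞)) ∧
    (Odd m → 5 ≤ G.maxDegree → ∀ n : ℕ, 2 * m + 2 ≤ n →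
      (fracPower G m n).chromaticNumber = ((fracPower G m n).cliqueNum : ℕ∞)) := by
  constructor
  · rintro heven hΔ n hn
    refine chromaticNumber_fracPower_eq G hn (by omega) ?_
    -- For m = 2k the greedy bound reads k * Δ ≥ 4k.
    have := Nat.mul_le_mul_left (m / 2) hΔ
    obtain ⟨k, rfl⟩ := heven
    omega
  · rintro hodd hΔ n hn
    refine chromaticNumber_fracPower_eq G hn (by omega) ?_
    -- For m = 2k + 1 it reads k * Δ ≥ 4k + 1, which follows from Δ ≥ 5 and k ≥ 1.
    have := Nat.mul_le_mul_left (m / 2) hΔ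
    obtain ⟨k, rfl⟩ := hodd
    omega
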